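/- For $\alpha>0$ and $z<1$ let ${\rm Li}_\alpha(z)=\frac{z}{\Gamma(\alpha)}\int_0^\infty\frac{t^{\alpha-1}}{e^t-z}\,dt$ be the polylogarithm, i.e. the analytic continuation of $\sum_{k\ge1}z^k/k^\alpha$. For every $\mu>0$ the saddle-point equation ${\rm Li}_{1/2}(-z)=-\sqrt\mu$ has exactly one solution $z=z_*(\mu)$ in $(-1,\infty)$. For a positive integer $N$, let the double-scaled free energy of $U(N)$ gauge theory on the torus be $$\hat{\mathcal F}_{U(N)}(\mu)=N\,\hat F\bigl(z_*(\mu),\mu\bigr),\qquad \hat F(z,\mu)=\frac{\pi\mu}{12}-\ln z-\frac1{\sqrt\mu}\,{\rm Li}_{3/2}(-z).$$ Then $\hat{\mathcal F}_{U(N)}$ has the asymptotic expansion $$\hat{\mathcal F}_{U(N)}(\mu)\sim\pi N\sum_{h=1}^\infty\frac{\xi_{2h-1}}{4h-3}\,\frac1{\mu^{2h-1}}\qquad(\mu\to\infty),$$ meaning that for each $n\ge0$ the difference between $\hat{\mathcal F}_{U(N)}(\mu)$ and the sum of the first $n$ terms is $O(\mu^{-(2n+1)})$, and its (uniquely determined)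 coefficients are, for $h\ge1$, $$\xi_{2h-1}=(4h-3)!\,\sum_{m=1}^h\frac{(-1)^{m-1}\,2^{m+2h-1}}{(4h-2-m)!}\sum_{\substack{\nu\in\mathbb N_0^h\\ \sum_k k\nu_k=h,\ \sum_k\nu_k=m}}\ \prod_{k=1}^h\frac1{\nu_k!}\left(\frac{(2^{2k-1}-1)\,(4k-3)!!\,|B_{2k}|}{(2k)!}\right)^{\nu_k},$$ where $B_{2k}$ are the Bernoulli numbers ($B_2=\frac16$, $B_4=-\frac1{30}$, …). -/

import Mathlib

open Filter Asymptotics Finset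
open scoped Nat

namespace DoubleScaling

/-- The polylogarithm (Jonquière) function `Li_α(z)` of real order `α > 0` at real `z < 1`, through
the integral representation `Li_α(z) = z / Γ(α) * ∫₀^∞ t^(α-1) / (e^t - z) dt`, which analytically
continues the series `∑_{k ≥ 1} z^k / k^α` from `|z| < 1` to the plane cut along `[1, ∞)`. -/
noncomputable def Li (α z : ℝ) : ℝ :=
  z / Real.Gamma α * ∫ t in Set.Ioi (0 : ℝ), t ^ (α - 1) / (Real.exp t - z)

/-- The exponent `F(z, μ)` of the integrand `e^{N F(z, μ)}` in the contour integral for the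
double-scaled zero-instanton partition function of `U(N)` gauge theory on the torus,
`Z(μ) = e^{π N μ / 12} ∮ dz / (2 π i z) exp (-N (ln z + Li_{3/2}(-z) / √μ))`. -/
noncomputable def action (z μ : ℝ) : ℝ :=
  Real.pi * μ / 12 - (Real.log z + 1 / √μ * Li (3 / 2) (-z))

/-- The saddle point `z_*(μ)`: the solution `z > -1` of the saddle-point equation
`Li_{1/2}(-z) = -√μ`, that is, the value at `-√μ` of the inverse of `z ↦ Li_{1/2}(-z)`
on `(-1, ∞)`. -/
noncomputable def saddlePoint (μ : ℝ) : ℝ :=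
  Function.invFunOn (fun z : ℝ => Li (1 / 2) (-z)) (Set.Ioi (-1)) (-√μ)

/-- The double-scaled free energy of `U(N)` gauge theory on the torus: `N` times the exponent
evaluated at the saddle point. -/
noncomputable def freeEnergy (N : ℕ) (μ : ℝ) : ℝ :=
  N * action (saddlePoint μ) μ

/-- `ξ 1, ξ 3, ξ 5, …` are the coefficients of the asymptotic expansion
`π N ∑_{h ≥ 1} ξ (2h-1) / ((4h-3) μ^(2h-1))` of the free energy as `μ → ∞`. -/
def IsExpansion (N : ℕ) (ξ : ℕ → ℝ) : Prop :=
  ∀ n : ℕ,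
    (fun μ : ℝ => freeEnergy N μ -
        Real.pi * N * ∑ h ∈ Icc 1 n, ξ (2 * h - 1) / (4 * (h : ℝ) - 3) * (1 / μ ^ (2 * h - 1)))
      =O[atTop] fun μ : ℝ => 1 / μ ^ (2 * n + 1)

/-- The sequences `ν = (ν_1, …, ν_h)` of non-negative integers with `∑ k ν_k = h` and `∑ ν_k = m`
(the partitions of `h` into `m` parts), as functions on `ℕ` that vanish outside `{1, …, h}`. -/
def partitionsWithParts (h m : ℕ) : Finset (ℕ → ℕ) :=
  (piAntidiag (Icc 1 h) m).filter fun ν => ∑ k ∈ Icc 1 h, k * ν k = h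

end DoubleScaling

/-!
Put `z = e^x`. Then `g(x) = -Li_{1/2}(-e^x)` and `G(x) = -Li_{3/2}(-e^x)` are Fermi-Dirac integrals
with `G' = g`, and `g` increases strictly from `0` to `∞`. So the saddle-point equation `g(x) = √μ`
has exactly one solution, and since `Li_{1/2}(-z) ≥ 0` for `-1 < z ≤ 0` there is none with `z ≤ 0`.

*Expansion of `g`.* An integration by parts (`Gamma_mul_fermiDirac_eq_integral_max`) gives
`Γ(α+1) x^{-α} (-Li_α(-e^x)) = ∫ (1 + r/x)_+^α k(r) dr`, where `k` is the even density of the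
logistic distribution. The Taylor polynomials of `(1 + ρ)_+^α` at `0` of degree `< N`, `N ≥ α`,
approximate this function up to `O(|ρ|^N)` on the whole line, so that integration of the Taylor
expansion yields the Sommerfeld expansion to all orders (`hasAsymptoticExpansion_fermiDirac`). The
moments of `k` are alternating zeta values, hence Bernoulli numbers. For `α = 1/2` the expansion is
`1 - 2 B(T)` with `T = (π / (2x))²` and `B` the generating series of the weights in the theorem
(`sommerfeldSeries_one_half`).

*Inversion.* Let `u = π / (2x)` and `w = μ / 2`. Then `w = φ / u`, where `φ = π μ / (4x)` has the
expansion `(1 - 2 B(u²))²`. Lagrange inversion, proved for formal power series by computing residues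
(`lagrange_inversion`), expresses `1/u` by `w`. It carries over to functions since asymptotic
expansions respect sums, products and inverses, and gives `x` in powers of `μ`
(`isBigO_saddle_expansion`). The multinomial theorem turns its coefficients, those of
`(1 - 2 B)^(4h-2)`, into sums over partitions (`lagrange_coeff_eq_sum_partitions`).

*Integration.* With `s = √μ`, the free energy is `N / s` times
`E = π s³ / 12 - s x + G(x)`, and `G' = g = s` implies `dE/ds = π s² / 4 - x`. As the leading terms
of `E` cancel, `E → 0`, and the expansion of `x` can be integrated term by term from infinity
(`isBigO_scaledAction_expansion`); the factor `1 / (4h - 3)` comes from this integration.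
Conversely the coefficients of an asymptotic expansion are unique (`IsExpansion.unique`).
-/

/-! ### Fermi-Dirac integrals -/

namespace DoubleScaling

open Real MeasureTheory Topology

/-- The density `e^r / (1 + e^r)^2` of the standard logistic distribution, which is the derivative
of the sigmoid function. -/
noncomputable def logisticDensity (r : ℝ) : ℝ := sigmoid r * sigmoid (-r)

lemma logisticDensity_pos (r : ℝ) : 0 < logisticDensity r :=
  mul_pos (sigmoid_pos r) (sigmoid_pos _)

lemma logisticDensity_neg (r : ℝ) : logisticDensity (-r) = logisticDensity r := by
  rw [logisticDensity, logisticDensity, neg_neg, mul_comm]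

@[fun_prop]
lemma continuous_logisticDensity : Continuous logisticDensity := by
  unfold logisticDensity
  exact continuous_sigmoid.mul (continuous_sigmoid.comp continuous_neg)

lemma hasDerivAt_sigmoid_logisticDensity (r : ℝ) : HasDerivAt sigmoid (logisticDensity r) r := by
  rw [logisticDensity, sigmoid_neg]
  exact hasDerivAt_sigmoid r

lemma sigmoid_le_exp (r : ℝ) : sigmoid r ≤ exp r := by
  rw [sigmoid_def, inv_le_comm₀ (by positivity) (exp_pos r), ← exp_neg]
  linarith

lemma logisticDensity_le_exp (r : ℝ) : logisticDensity r ≤ exp r :=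
  (mul_le_of_le_one_right (sigmoid_nonneg r) (sigmoid_le_one _)).trans (sigmoid_le_exp r)

/-- The complete Fermi-Dirac integral `-Li_α(-e^x)` of order `α - 1`. -/
noncomputable def fermiDirac (α x : ℝ) : ℝ :=
  (Gamma α)⁻¹ * ∫ t in Set.Ioi (0 : ℝ), t ^ (α - 1) * sigmoid (x - t)

lemma Li_neg_exp (α x : ℝ) : Li α (-exp x) = -fermiDirac α x := by
  have h : ∀ t : ℝ, t ^ (α - 1) / (exp t - -exp x) =
      exp (-x) * (t ^ (α - 1) * sigmoid (x - t)) := by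
    intro t
    have h1 : exp t = exp x * exp (-(x - t)) := by rw [← exp_add]; ring_nf
    have h2 := exp_pos (-(x - t))
    have h3 := exp_pos x
    rw [sigmoid_def, h1, exp_neg x]
    generalize exp (-(x - t)) = e at h2 ⊢
    rw [show exp x * e - -exp x = exp x * (1 + e) by ring]
    field_simp
  simp only [Li, h, fermiDirac, integral_const_mul]
  rw [exp_neg]
  field_simp

lemma integrableOn_rpow_mul_exp {α : ℝ} (hα : 0 < α) (x : ℝ) :
    IntegrableOn (fun t : ℝ => t ^ (α - 1) * exp (x - t)) (Set.Ioi 0) := by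
  refine ((GammaIntegral_convergent hα).const_mul (exp x)).congr (ae_of_all _ fun t => ?_)
  simp only [sub_eq_add_neg, exp_add]
  ring

lemma integral_rpow_mul_exp {α : ℝ} (hα : 0 < α) (x : ℝ) :
    ∫ t in Set.Ioi (0 : ℝ), t ^ (α - 1) * exp (x - t) = exp x * Gamma α := by
  rw [Gamma_eq_integral hα, ← integral_const_mul]
  congr with t
  simp only [sub_eq_add_neg, exp_add]
  ring

lemma integrableOn_rpow_mul_of_le_exp {α : ℝ} (hα : 0 < α) {x : ℝ} {f : ℝ → ℝ} (hf : Continuous f)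
    (hf0 : ∀ t, 0 ≤ f t) (hfe : ∀ t, f t ≤ exp (x - t)) :
    IntegrableOn (fun t : ℝ => t ^ (α - 1) * f t) (Set.Ioi 0) := by
  refine Integrable.mono' (integrableOn_rpow_mul_exp hα x) ?_ ?_
  · exact ((measurable_id.pow_const _).mul hf.measurable).aestronglyMeasurable
  · filter_upwards [ae_restrict_mem measurableSet_Ioi] with t ht
    have h0 : (0 : ℝ) ≤ t ^ (α - 1) := rpow_nonneg (le_of_lt ht) _
    rw [norm_of_nonneg (mul_nonneg h0 (hf0 t))]
    exact mul_le_mul_of_nonneg_left (hfe t) h0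

lemma integrableOn_rpow_mul_sigmoid {α : ℝ} (hα : 0 < α) (x : ℝ) :
    IntegrableOn (fun t : ℝ => t ^ (α - 1) * sigmoid (x - t)) (Set.Ioi 0) :=
  integrableOn_rpow_mul_of_le_exp hα (by fun_prop) (fun _ => sigmoid_nonneg _)
    fun _ => sigmoid_le_exp _

lemma integrableOn_rpow_mul_logisticDensity {α : ℝ} (hα : 0 < α) (x : ℝ) :
    IntegrableOn (fun t : ℝ => t ^ (α - 1) * logisticDensity (x - t)) (Set.Ioi 0) :=
  integrableOn_rpow_mul_of_le_exp hα (by fun_prop) (fun _ => (logisticDensity_pos _).le)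
    fun _ => logisticDensity_le_exp _

lemma setIntegral_Ioi_pos {f : ℝ → ℝ} (hf : IntegrableOn f (Set.Ioi 0)) (h : ∀ t > 0, 0 < f t) :
    0 < ∫ t in Set.Ioi (0 : ℝ), f t := by
  have hsupp : Set.Ioi (0 : ℝ) ⊆ Function.support f := fun t ht => (h t ht).ne'
  rw [setIntegral_pos_iff_support_of_nonneg_ae ?_ hf, Set.inter_eq_self_of_subset_right hsupp]
  · simp
  · filter_upwards [ae_restrict_mem measurableSet_Ioi] with t ht using (h t ht).le

lemma fermiDirac_pos {α : ℝ} (hα : 0 < α) (x : ℝ) : 0 < fermiDirac α x :=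
  mul_pos (inv_pos.2 (Gamma_pos_of_pos hα)) <|
    setIntegral_Ioi_pos (integrableOn_rpow_mul_sigmoid hα x) fun _ ht =>
      mul_pos (rpow_pos_of_pos ht _) (sigmoid_pos _)

lemma fermiDirac_le_exp {α : ℝ} (hα : 0 < α) (x : ℝ) : fermiDirac α x ≤ exp x := by
  rw [fermiDirac, inv_mul_le_iff₀ (Gamma_pos_of_pos hα), mul_comm (Gamma α),
    ← integral_rpow_mul_exp hα x]
  refine setIntegral_mono_on (integrableOn_rpow_mul_sigmoid hα x) (integrableOn_rpow_mul_exp hα x)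
    measurableSet_Ioi fun t ht => ?_
  exact mul_le_mul_of_nonneg_left (sigmoid_le_exp _) (rpow_nonneg (le_of_lt ht) _)

lemma tendsto_fermiDirac_atBot {α : ℝ} (hα : 0 < α) : Tendsto (fermiDirac α) atBot (𝓝 0) :=
  squeeze_zero (fun x => (fermiDirac_pos hα x).le) (fermiDirac_le_exp hα) tendsto_exp_atBot

/-- Differentiation under the integral sign: only the smooth factor depends on `x`. -/
lemma hasDerivAt_fermiDirac_integral {α : ℝ} (hα : 0 < α) (x : ℝ) :
    HasDerivAt (fermiDirac α)
      ((Gamma α)⁻¹ * ∫ t in Set.Ioi (0 : ℝ), t ^ (α - 1) * logisticDensity (x - t)) x := by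
  refine HasDerivAt.const_mul _ ?_
  refine (hasDerivAt_integral_of_dominated_loc_of_deriv_le (s := Set.Iio (x + 1))
    (bound := fun t : ℝ => t ^ (α - 1) * exp (x + 1 - t))
    (F := fun x t : ℝ => t ^ (α - 1) * sigmoid (x - t))
    (F' := fun x t : ℝ => t ^ (α - 1) * logisticDensity (x - t))
    (Iio_mem_nhds (by linarith)) ?_ (integrableOn_rpow_mul_sigmoid hα x) ?_ ?_
    (integrableOn_rpow_mul_exp hα _) ?_).2
  · exact Eventually.of_forall fun y => (integrableOn_rpow_mul_sigmoid hα y).aestronglyMeasurable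
  · exact (integrableOn_rpow_mul_logisticDensity hα x).aestronglyMeasurable
  · filter_upwards [ae_restrict_mem measurableSet_Ioi] with t ht y hy
    have h0 : (0 : ℝ) ≤ t ^ (α - 1) := rpow_nonneg (le_of_lt ht) _
    rw [norm_of_nonneg (mul_nonneg h0 (logisticDensity_pos _).le)]
    refine mul_le_mul_of_nonneg_left ((logisticDensity_le_exp _).trans ?_) h0
    exact exp_le_exp.2 (by linarith [Set.mem_Iio.1 hy])
  · refine ae_of_all _ fun t y _ => HasDerivAt.const_mul _ ?_
    simpa using! (hasDerivAt_sigmoid_logisticDensity (y - t)).comp y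
      ((hasDerivAt_id y).sub_const t)

lemma strictMono_fermiDirac {α : ℝ} (hα : 0 < α) : StrictMono (fermiDirac α) := by
  refine strictMono_of_deriv_pos fun x => ?_
  rw [(hasDerivAt_fermiDirac_integral hα x).deriv]
  exact mul_pos (inv_pos.2 (Gamma_pos_of_pos hα)) <|
    setIntegral_Ioi_pos (integrableOn_rpow_mul_logisticDensity hα x) fun _ ht =>
      mul_pos (rpow_pos_of_pos ht _) (logisticDensity_pos _)

lemma continuous_fermiDirac {α : ℝ} (hα : 0 < α) : Continuous (fermiDirac α) :=
  continuous_iff_continuousAt.2 fun x => (hasDerivAt_fermiDirac_integral hα x).continuousAt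

/-- Integration by parts in the Fermi-Dirac integral. -/
lemma fermiDirac_eq_integral_logisticDensity {α : ℝ} (hα : 0 < α) (x : ℝ) :
    fermiDirac α x =
      (Gamma (α + 1))⁻¹ * ∫ t in Set.Ioi (0 : ℝ), t ^ α * logisticDensity (x - t) := by
  have hα1 : 0 < α + 1 := by linarith
  have hσ : ∀ t, HasDerivAt (fun t => sigmoid (x - t)) (-logisticDensity (x - t)) t := fun t => by
    simpa using! (hasDerivAt_sigmoid_logisticDensity (x - t)).comp t
      ((hasDerivAt_id t).const_sub x)
  have hpow : ∀ t ∈ Set.Ioi (0 : ℝ), HasDerivAt (fun t : ℝ => t ^ α) (α * t ^ (α - 1)) t :=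
    fun t ht => hasDerivAt_rpow_const (Or.inl (ne_of_gt ht))
  have h1 := integrableOn_rpow_mul_logisticDensity hα1 x
  have h2 := integrableOn_rpow_mul_sigmoid hα x
  simp only [add_sub_cancel_right] at h1
  have key := integral_Ioi_mul_deriv_eq_deriv_mul (a := 0) (a' := 0) (b' := 0)
    (u := fun t : ℝ => t ^ α) (v := fun t => sigmoid (x - t)) hpow (fun t _ => hσ t) ?_ ?_ ?_ ?_
  · simp only [mul_neg, integral_neg, mul_assoc, integral_const_mul] at key
    rw [Gamma_add_one hα.ne', fermiDirac,
      show (∫ t in Set.Ioi (0 : ℝ), t ^ α * logisticDensity (x - t)) =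
        α * ∫ t in Set.Ioi (0 : ℝ), t ^ (α - 1) * sigmoid (x - t) by linarith]
    have := (Gamma_pos_of_pos hα).ne'
    field_simp
  · simpa [Pi.mul_def] using h1.neg
  · refine (h2.const_mul α).congr (ae_of_all _ fun t => ?_)
    simp [mul_assoc]
  · have : Tendsto (fun t : ℝ => t ^ α * sigmoid (x - t)) (𝓝 0) (𝓝 (0 ^ α * sigmoid (x - 0))) :=
      (continuousAt_rpow_const 0 α (Or.inr hα.le)).mul (hσ 0).continuousAt
    rw [zero_rpow hα.ne', zero_mul] at this
    exact this.mono_left nhdsWithin_le_nhds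
  · have : Tendsto (fun t : ℝ => exp x * (t ^ α * exp (-1 * t))) atTop (𝓝 (exp x * 0)) :=
      (tendsto_rpow_mul_exp_neg_mul_atTop_nhds_zero α 1 one_pos).const_mul _
    rw [mul_zero] at this
    refine squeeze_zero' ?_ ?_ this
    · filter_upwards [eventually_ge_atTop 0] with t ht
      exact mul_nonneg (rpow_nonneg ht _) (sigmoid_nonneg _)
    · filter_upwards [eventually_ge_atTop 0] with t ht
      calc t ^ α * sigmoid (x - t) ≤ t ^ α * exp (x - t) :=
            mul_le_mul_of_nonneg_left (sigmoid_le_exp _) (rpow_nonneg ht _)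
        _ = _ := by rw [sub_eq_add_neg, exp_add]; ring_nf

lemma hasDerivAt_fermiDirac_add_one {α : ℝ} (hα : 0 < α) (x : ℝ) :
    HasDerivAt (fermiDirac (α + 1)) (fermiDirac α x) x := by
  have := hasDerivAt_fermiDirac_integral (add_pos hα one_pos) x
  rwa [add_sub_cancel_right, ← fermiDirac_eq_integral_logisticDensity hα x] at this

/-- The integral over `t > 0` becomes one over the whole line against the even logistic density;
the truncation `max (x + r) 0` takes care of the lower end of the range. -/
lemma Gamma_mul_fermiDirac_eq_integral_max {α : ℝ} (hα : 0 < α) (x : ℝ) :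
    Gamma (α + 1) * fermiDirac α x = ∫ r : ℝ, max (x + r) 0 ^ α * logisticDensity r := by
  have hΓ := (Gamma_pos_of_pos (add_pos hα one_pos)).ne'
  rw [fermiDirac_eq_integral_logisticDensity hα, mul_inv_cancel_left₀ hΓ,
    ← integral_indicator measurableSet_Ioi,
    ← integral_add_left_eq_self _ x]
  congr with r
  rcases lt_or_ge 0 (x + r) with h | h
  · rw [Set.indicator_of_mem (Set.mem_Ioi.2 h), max_eq_left h.le, ← logisticDensity_neg r]
    ring_nf
  · rw [Set.indicator_of_notMem (fun h' => absurd (Set.mem_Ioi.1 h') h.not_gt), max_eq_right h,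
      zero_rpow hα.ne', zero_mul]

end DoubleScaling

/-! ### Moments of the logistic distribution -/

namespace DoubleScaling

open Real MeasureTheory Topology

lemma logisticDensity_abs (r : ℝ) : logisticDensity |r| = logisticDensity r := by
  rcases abs_choice r with h | h <;> rw [h]
  exact logisticDensity_neg r

lemma integrableOn_pow_mul_logisticDensity (n : ℕ) :
    IntegrableOn (fun r : ℝ => r ^ n * logisticDensity r) (Set.Ioi 0) := by
  refine (integrableOn_rpow_mul_logisticDensity (α := n + 1) (by positivity) 0).congr
    (ae_of_all _ fun r => ?_)
  simp [logisticDensity_neg]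

lemma integrable_abs_pow_mul_logisticDensity (n : ℕ) :
    Integrable fun r : ℝ => |r| ^ n * logisticDensity r := by
  have h := integrableOn_pow_mul_logisticDensity n
  have hpos : IntegrableOn (fun r : ℝ => |r| ^ n * logisticDensity r) (Set.Ioi 0) :=
    h.congr_fun (fun r hr => by simp only [abs_of_pos (Set.mem_Ioi.1 hr)]) measurableSet_Ioi
  rw [← integrableOn_univ, ← Set.Iic_union_Ioi (a := (0 : ℝ)), integrableOn_union]
  refine ⟨?_, hpos⟩
  rw [integrableOn_Iic_iff_integrableOn_Iio,
    ← (Measure.measurePreserving_neg volume).integrableOn_comp_preimage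
      (Homeomorph.neg ℝ).measurableEmbedding]
  simpa [Function.comp_def, logisticDensity_neg] using hpos

lemma integrable_pow_mul_logisticDensity (n : ℕ) :
    Integrable fun r : ℝ => r ^ n * logisticDensity r := by
  refine (integrable_abs_pow_mul_logisticDensity n).mono' (by fun_prop) (ae_of_all _ fun r => ?_)
  rw [norm_mul, norm_pow, norm_eq_abs, norm_of_nonneg (logisticDensity_pos r).le]

lemma integral_logisticDensity : ∫ r, logisticDensity r = 1 := by
  have h := integral_of_hasDerivAt_of_tendsto hasDerivAt_sigmoid_logisticDensity
    (by simpa using integrable_pow_mul_logisticDensity 0) tendsto_sigmoid_atBot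
    tendsto_sigmoid_atTop
  rw [h, sub_zero]

lemma integral_odd_pow_mul_logisticDensity {n : ℕ} (hn : Odd n) :
    ∫ r : ℝ, r ^ n * logisticDensity r = 0 := by
  have h := integral_neg_eq_self (fun r : ℝ => r ^ n * logisticDensity r) volume
  simp only [hn.neg_pow, logisticDensity_neg, neg_mul, integral_neg] at h
  linarith

lemma hasSum_logisticDensity {r : ℝ} (hr : 0 < r) :
    HasSum (fun n : ℕ => -((-1) ^ n * n) * exp (-(n * r))) (logisticDensity r) := by
  have hq : ‖-exp (-r)‖ < 1 := by
    rw [norm_neg, norm_of_nonneg (exp_pos _).le]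
    simpa using hr
  convert! (hasSum_coe_mul_geometric_of_norm_lt_one hq).neg using 1
  · ext n
    rw [neg_pow (exp (-r)), ← exp_nat_mul, mul_neg]
    ring
  · rw [logisticDensity, ← sigmoid_mul_rexp_neg, sigmoid_def, sub_neg_eq_add]
    have := exp_pos (-r)
    field_simp

/-- Alternating sum of the even zeta value. -/
lemma hasSum_eta_nat {k : ℕ} (hk : k ≠ 0) :
    HasSum (fun n : ℕ => -(-1 : ℝ) ^ n / n ^ (2 * k))
      ((2 ^ (2 * k - 1) - 1) * π ^ (2 * k) * |(bernoulli (2 * k) : ℝ)| / (2 * k)!) := by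
  obtain ⟨Z, hZ⟩ : ∃ Z, Z = (2 : ℝ) ^ (2 * k - 1) * π ^ (2 * k) * |(bernoulli (2 * k) : ℝ)| /
    (2 * k)! := ⟨_, rfl⟩
  have hsum : HasSum (fun n : ℕ => 1 / (n : ℝ) ^ (2 * k)) Z := by
    have h := hasSum_zeta_nat hk
    have h0 := h.nonneg fun n => by positivity
    -- positivity of the sum fixes the sign of the Bernoulli number
    rw [← abs_of_nonneg h0] at h
    rw [hZ]
    simpa [abs_mul, abs_div, abs_of_pos pi_pos] using h
  have heven : HasSum (fun n : ℕ => 1 / ((2 * n : ℕ) : ℝ) ^ (2 * k)) (Z / 2 ^ (2 * k)) := by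
    convert! hsum.div_const ((2 : ℝ) ^ (2 * k)) using 2 with n
    push_cast
    rw [mul_pow, div_div, mul_comm]
  have hodd : HasSum (fun n : ℕ => 1 / ((2 * n + 1 : ℕ) : ℝ) ^ (2 * k)) (Z - Z / 2 ^ (2 * k)) := by
    have hs : Summable (fun n : ℕ => 1 / ((2 * n + 1 : ℕ) : ℝ) ^ (2 * k)) :=
      hsum.summable.comp_injective (i := fun n => 2 * n + 1) fun a b h => by simpa using h
    have h2 := heven.even_add_odd (f := fun n : ℕ => 1 / (n : ℝ) ^ (2 * k)) hs.hasSum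
    rw [sub_eq_of_eq_add' (hsum.unique h2)]
    exact hs.hasSum
  have h2k : (2 : ℝ) ^ (2 * k) = 2 * 2 ^ (2 * k - 1) := by
    rw [← pow_succ']
    congr 1
    omega
  convert! HasSum.even_add_odd (f := fun n : ℕ => -(-1 : ℝ) ^ n / n ^ (2 * k))
    (m := -(Z / 2 ^ (2 * k))) (m' := Z - Z / 2 ^ (2 * k)) ?_ ?_ using 1
  · rw [hZ, h2k]
    field_simp
    ring
  · convert! heven.neg using 2 with n
    simp [pow_mul, neg_div]
  · convert! hodd using 2 with n
    simp [pow_succ, pow_mul]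

/-- The even moments of the logistic distribution: expand the density in powers of `e^{-r}` and
integrate term by term. -/
lemma integral_even_pow_mul_logisticDensity {k : ℕ} (hk : k ≠ 0) :
    ∫ r : ℝ, r ^ (2 * k) * logisticDensity r =
      2 * (2 ^ (2 * k - 1) - 1) * π ^ (2 * k) * |(bernoulli (2 * k) : ℝ)| := by
  have hint : ∀ n : ℕ, n ≠ 0 →
      IntegrableOn (fun r : ℝ => r ^ (2 * k) * exp (-(n * r))) (Set.Ioi 0) ∧
      ∫ r in Set.Ioi (0 : ℝ), r ^ (2 * k) * exp (-(n * r)) =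
        (1 / n) ^ (2 * k + 1) * (2 * k)! := by
    intro n hn
    have hn' : (0 : ℝ) < n := by exact_mod_cast Nat.pos_of_ne_zero hn
    have h := integral_rpow_mul_exp_neg_mul_Ioi (a := 2 * k + 1) (by positivity) hn'
    have h2 : ∫ r in Set.Ioi (0 : ℝ), r ^ (2 * k) * exp (-(n * r)) =
        (1 / n) ^ (2 * k + 1) * (2 * k)! := by
      have hΓ : Gamma (2 * k + 1) = (2 * k)! := by exact_mod_cast Gamma_nat_eq_factorial (2 * k)
      rw [← hΓ]
      refine Eq.trans ?_ (h.trans ?_)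
      · congr with r
        rw [add_sub_cancel_right]
        norm_cast
      · norm_cast
    refine ⟨?_, h2⟩
    refine not_imp_comm.1 integral_undef ?_
    rw [h2]
    positivity
  have hF : ∀ n : ℕ, IntegrableOn
      (fun r : ℝ => -((-1) ^ n * n) * (r ^ (2 * k) * exp (-(n * r)))) (Set.Ioi 0) := by
    intro n
    rcases eq_or_ne n 0 with rfl | hn
    · simp
    · exact (hint n hn).1.const_mul _
  have hval : ∀ n : ℕ, ∫ r in Set.Ioi (0 : ℝ), -((-1) ^ n * n) * (r ^ (2 * k) * exp (-(n * r))) =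
      -(-1 : ℝ) ^ n / n ^ (2 * k) * (2 * k)! := by
    intro n
    rcases eq_or_ne n 0 with rfl | hn
    · simp [hk]
    · have hn' : (n : ℝ) ≠ 0 := by exact_mod_cast hn
      rw [integral_const_mul, (hint n hn).2, pow_succ, one_div_pow]
      field_simp
  have hnorm : ∀ n : ℕ,
      ∫ r in Set.Ioi (0 : ℝ), ‖-((-1) ^ n * n) * (r ^ (2 * k) * exp (-(n * r)))‖ =
      1 / n ^ (2 * k) * (2 * k)! := by
    intro n
    rcases eq_or_ne n 0 with rfl | hn
    · simp [hk]
    · have hn' : (n : ℝ) ≠ 0 := by exact_mod_cast hn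
      have h : ∀ r : ℝ, ‖-((-1) ^ n * n) * (r ^ (2 * k) * exp (-(n * r)))‖ =
          n * (r ^ (2 * k) * exp (-(n * r))) := by
        intro r
        have h1 : 0 ≤ r ^ (2 * k) * exp (-(n * r)) :=
          mul_nonneg ((even_two_mul k).pow_nonneg r) (exp_pos _).le
        rw [norm_mul, norm_of_nonneg h1]
        simp
      simp only [h]
      rw [integral_const_mul, (hint n hn).2, pow_succ, one_div_pow]
      field_simp
  have hsum := hasSum_integral_of_summable_integral_norm hF (by
    simp only [hnorm]
    exact (summable_one_div_nat_pow.2 (by omega)).mul_right _)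
  simp only [hval] at hsum
  have hhalf := hsum.unique ((hasSum_eta_nat hk).mul_right _)
  have htsum : ∫ r in Set.Ioi (0 : ℝ), ∑' n : ℕ, -((-1) ^ n * n) * (r ^ (2 * k) * exp (-(n * r))) =
      ∫ r in Set.Ioi (0 : ℝ), r ^ (2 * k) * logisticDensity r := by
    refine setIntegral_congr_fun measurableSet_Ioi fun r hr => ?_
    have := ((hasSum_logisticDensity hr).mul_left (r ^ (2 * k))).tsum_eq
    simp only [← this]
    congr with n
    ring
  have habs := integral_comp_abs (f := fun r : ℝ => r ^ (2 * k) * logisticDensity r)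
  simp only [logisticDensity_abs, (even_two_mul k).pow_abs] at habs
  rw [habs, ← htsum, hhalf]
  field_simp

end DoubleScaling

/-! ### Asymptotic power series expansions -/

namespace DoubleScaling

open Topology PowerSeries

/-- `f` has the (Poincaré) asymptotic expansion `∑ i, p_i T ^ i` along the filter `l`, where `T` is
the small parameter and the formal power series `p` collects the coefficients. -/
def HasAsymptoticExpansion (l : Filter ℝ) (T f : ℝ → ℝ) (p : PowerSeries ℝ) : Prop :=
  ∀ n : ℕ, (fun x => f x - (trunc n p).eval (T x)) =O[l] fun x => T x ^ n

section AsymptoticExpansion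

variable {l : Filter ℝ} {T f g : ℝ → ℝ} {p q : PowerSeries ℝ}

lemma eval_trunc_eq_sum (n : ℕ) (p : PowerSeries ℝ) (y : ℝ) :
    (trunc n p).eval y = ∑ i ∈ range n, coeff i p * y ^ i := by
  exact eval₂_trunc_eq_sum_range y (RingHom.id ℝ) n p

lemma isBigO_polynomial_eval (hT : Tendsto T l (𝓝 0)) (P : Polynomial ℝ) :
    (fun x => P.eval (T x)) =O[l] fun _ => (1 : ℝ) :=
  ((P.continuous.tendsto 0).comp hT).isBigO_one ℝ

lemma isBigO_polynomial_eval_of_dvd (hT : Tendsto T l (𝓝 0)) {P : Polynomial ℝ} {n : ℕ}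
    (h : Polynomial.X ^ n ∣ P) : (fun x => P.eval (T x)) =O[l] fun x => T x ^ n := by
  obtain ⟨Q, rfl⟩ := h
  simpa using (isBigO_refl (fun x => T x ^ n) l).mul (isBigO_polynomial_eval hT Q)

lemma hasAsymptoticExpansion_polynomial (hT : Tendsto T l (𝓝 0)) (P : Polynomial ℝ) :
    HasAsymptoticExpansion l T (fun x => P.eval (T x)) P := by
  intro n
  simp only [← Polynomial.eval_sub]
  refine isBigO_polynomial_eval_of_dvd hT (Polynomial.X_pow_dvd_iff.2 fun d hd => ?_)
  simp [coeff_trunc, hd]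

lemma hasAsymptoticExpansion_const (hT : Tendsto T l (𝓝 0)) (c : ℝ) :
    HasAsymptoticExpansion l T (fun _ => c) (C c) := by
  simpa using hasAsymptoticExpansion_polynomial hT (Polynomial.C c)

lemma hasAsymptoticExpansion_self (hT : Tendsto T l (𝓝 0)) :
    HasAsymptoticExpansion l T T X := by
  simpa using hasAsymptoticExpansion_polynomial hT Polynomial.X

lemma HasAsymptoticExpansion.congr' (hf : HasAsymptoticExpansion l T f p) (h : f =ᶠ[l] g) :
    HasAsymptoticExpansion l T g p := fun n =>
  (hf n).congr' (h.mono fun x hx => by simp only [hx]) EventuallyEq.rfl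

lemma HasAsymptoticExpansion.isBigO_one (hf : HasAsymptoticExpansion l T f p) :
    f =O[l] fun _ => (1 : ℝ) := by
  simpa using hf 0

lemma HasAsymptoticExpansion.tendsto (hT : Tendsto T l (𝓝 0))
    (hf : HasAsymptoticExpansion l T f p) : Tendsto f l (𝓝 (constantCoeff p)) := by
  have h := (hf 1).trans_tendsto (by simpa using hT)
  simpa [eval_trunc_eq_sum] using h.add_const (constantCoeff p)

lemma HasAsymptoticExpansion.add (hf : HasAsymptoticExpansion l T f p)
    (hg : HasAsymptoticExpansion l T g q) :
    HasAsymptoticExpansion l T (fun x => f x + g x) (p + q) := fun n =>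
  ((hf n).add (hg n)).congr_left fun x => by simp; ring

lemma HasAsymptoticExpansion.mul (hT : Tendsto T l (𝓝 0)) (hf : HasAsymptoticExpansion l T f p)
    (hg : HasAsymptoticExpansion l T g q) :
    HasAsymptoticExpansion l T (fun x => f x * g x) (p * q) := by
  intro n
  have h1 : (fun x => f x * (g x - (trunc n q).eval (T x))) =O[l] fun x => T x ^ n := by
    simpa using hf.isBigO_one.mul (hg n)
  have h2 : (fun x => (trunc n q).eval (T x) * (f x - (trunc n p).eval (T x))) =O[l]
      fun x => T x ^ n := by
    simpa using (isBigO_polynomial_eval hT (trunc n q)).mul (hf n)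
  have h3 : (fun x => (trunc n p * trunc n q - trunc n (p * q)).eval (T x)) =O[l]
      fun x => T x ^ n := by
    refine isBigO_polynomial_eval_of_dvd hT (Polynomial.X_pow_dvd_iff.2 fun d hd => ?_)
    rw [Polynomial.coeff_sub, coeff_trunc, if_pos hd, coeff_mul_eq_coeff_trunc_mul_trunc p q hd,
      ← Polynomial.coe_mul, Polynomial.coeff_coe, sub_self]
  refine ((h1.add h2).add h3).congr_left fun x => ?_
  simp only [Polynomial.eval_sub, Polynomial.eval_mul]
  ring

lemma HasAsymptoticExpansion.const_mul (hT : Tendsto T l (𝓝 0)) (c : ℝ)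
    (hf : HasAsymptoticExpansion l T f p) :
    HasAsymptoticExpansion l T (fun x => c * f x) (C c * p) :=
  (hasAsymptoticExpansion_const hT c).mul hT hf

lemma HasAsymptoticExpansion.pow (hT : Tendsto T l (𝓝 0)) (hf : HasAsymptoticExpansion l T f p)
    (m : ℕ) : HasAsymptoticExpansion l T (fun x => f x ^ m) (p ^ m) := by
  induction m with
  | zero => simpa using hasAsymptoticExpansion_const hT 1
  | succ m ih => simpa only [pow_succ] using ih.mul hT hf

lemma HasAsymptoticExpansion.sum (hT : Tendsto T l (𝓝 0)) {ι : Type*} (s : Finset ι)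
    {F : ι → ℝ → ℝ} {P : ι → PowerSeries ℝ}
    (h : ∀ i ∈ s, HasAsymptoticExpansion l T (F i) (P i)) :
    HasAsymptoticExpansion l T (fun x => ∑ i ∈ s, F i x) (∑ i ∈ s, P i) := by
  classical
  induction s using Finset.induction_on with
  | empty => simpa using hasAsymptoticExpansion_const hT 0
  | insert i s hi ih =>
    simp only [sum_insert hi]
    exact (h i (mem_insert_self i s)).add (ih fun j hj => h j (mem_insert_of_mem hj))

lemma HasAsymptoticExpansion.isBigO_pow (hf : HasAsymptoticExpansion l T f p) {n : ℕ}
    (h : ∀ i < n, coeff i p = 0) : f =O[l] fun x => T x ^ n := by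
  refine (hf n).congr_left fun x => ?_
  rw [eval_trunc_eq_sum, sum_eq_zero fun i hi => by rw [h i (mem_range.1 hi), zero_mul], sub_zero]

lemma HasAsymptoticExpansion.inv (hT : Tendsto T l (𝓝 0)) (hf : HasAsymptoticExpansion l T f p)
    (hp : constantCoeff p ≠ 0) : HasAsymptoticExpansion l T (fun x => (f x)⁻¹) p⁻¹ := by
  intro n
  have hinv : (fun x => (f x)⁻¹) =O[l] fun _ => (1 : ℝ) := ((hf.tendsto hT).inv₀ hp).isBigO_one ℝ
  have h1 := (hasAsymptoticExpansion_const hT 1).add <|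
    (hf.mul hT (hasAsymptoticExpansion_polynomial hT (trunc n p⁻¹))).const_mul hT (-1)
  have h2 := hinv.mul (h1.isBigO_pow (n := n) fun i hi => ?_)
  · refine h2.congr' ?_ (by simp)
    filter_upwards [(hf.tendsto hT).eventually_ne hp] with x hx
    field_simp
    ring
  · have : p * p⁻¹ = 1 := PowerSeries.mul_inv_cancel p hp
    rw [map_add, coeff_C_mul, coeff_mul_eq_coeff_trunc_mul_trunc _ _ hi, trunc_trunc,
      ← coeff_mul_eq_coeff_trunc_mul_trunc _ _ hi, this, coeff_one, coeff_C]
    split_ifs <;> simp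

end AsymptoticExpansion

end DoubleScaling

/-! ### Lagrange inversion -/

namespace DoubleScaling

open PowerSeries

/-- Residues of exact differentials, in the guise of coefficients: with `w = X^(-1/2) Φ` the series
`Φ^a (2 X Φ' - Φ)` is `2 X w^a dw/dX` up to a power of `X`. In particular its coefficient at `X^j`
vanishes when `a + 1 = 2 j ≠ 0`. -/
lemma coeff_pow_mul_derivative {K : Type*} [Field K] [CharZero K] (Φ : PowerSeries K) (j a : ℕ) :
    ((a : K) + 1) * coeff j (Φ ^ a * (2 * X * d⁄dX K Φ - Φ)) =
      (2 * j - (a + 1)) * coeff j (Φ ^ (a + 1)) := by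
  have h : ((a : PowerSeries K) + 1) * (Φ ^ a * (2 * X * d⁄dX K Φ - Φ)) =
      2 * (X * d⁄dX K (Φ ^ (a + 1))) - ((a : PowerSeries K) + 1) * Φ ^ (a + 1) := by
    rw [derivative_pow, Nat.add_sub_cancel]
    push_cast
    ring
  have hX : coeff j (X * d⁄dX K (Φ ^ (a + 1))) = j * coeff j (Φ ^ (a + 1)) := by
    cases j with
    | zero => simp
    | succ j => rw [coeff_succ_X_mul, coeff_derivative, mul_comm]; push_cast; rfl
  have hC : ((a : PowerSeries K) + 1) = C ((a : K) + 1) := by simp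
  have h2 : (2 : PowerSeries K) = C (2 : K) := (map_ofNat C 2).symm
  have := congrArg (coeff j) h
  rw [hC, coeff_C_mul, map_sub, coeff_C_mul, h2, coeff_C_mul, hX, ← h2] at this
  rw [this]
  ring

/-- A form of Lagrange inversion: if `w = φ(u²) / u` with `φ(0) = 1`, then
`1 / u = w - ∑ h, [X^h] φ^(2h-1) / (2h-1) * w^(-(2h-1))`, here with `X = u²` and multiplied
by `u`. -/
lemma lagrange_inversion {K : Type*} [Field K] [CharZero K] {Φ : PowerSeries K}
    (hΦ : constantCoeff Φ = 1) (n : ℕ) :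
    ∀ i < n + 1, coeff i (1 - Φ + ∑ h ∈ Icc 1 n,
      C (coeff h (Φ ^ (2 * h - 1)) / (2 * h - 1)) * (X ^ h * Φ⁻¹ ^ (2 * h - 1))) = 0 := by
  have hne : constantCoeff Φ ≠ 0 := by simp [hΦ]
  induction n with
  | zero =>
    intro i hi
    obtain rfl : i = 0 := by omega
    simp [hΦ]
  | succ n ih =>
    set R := 1 - Φ + ∑ h ∈ Icc 1 n,
      C (coeff h (Φ ^ (2 * h - 1)) / (2 * h - 1)) * (X ^ h * Φ⁻¹ ^ (2 * h - 1)) with hR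
    obtain ⟨Q, hQ⟩ := X_pow_dvd_iff.2 ih
    -- pair the remainder with the differential of `w^(2n+1)`
    set D := 2 * X * d⁄dX K Φ - Φ with hD
    have hD0 : constantCoeff D = -1 := by simp [hD, hΦ]
    have hleft : coeff (n + 1) (R * (Φ ^ (2 * n) * D)) = -coeff (n + 1) R := by
      rw [hQ, mul_assoc, coeff_X_pow_mul', coeff_X_pow_mul']
      simp [hD0, hΦ]
    have hright : coeff (n + 1) (R * (Φ ^ (2 * n) * D)) =
        coeff (n + 1) (Φ ^ (2 * n + 1)) / (2 * (n + 1 : ℕ) - 1) := by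
      have hterm : ∀ h ∈ Icc 1 n, coeff (n + 1)
          (C (coeff h (Φ ^ (2 * h - 1)) / (2 * h - 1)) * (X ^ h * Φ⁻¹ ^ (2 * h - 1)) *
            (Φ ^ (2 * n) * D)) = 0 := by
        intro h hh
        obtain ⟨h1, h2⟩ := mem_Icc.1 hh
        obtain ⟨d, rfl⟩ := Nat.exists_eq_add_of_le h2
        have hcancel : Φ⁻¹ ^ (2 * h - 1) * Φ ^ (2 * (h + d)) = Φ ^ (2 * d + 1) := by
          rw [show 2 * (h + d) = (2 * h - 1) + (2 * d + 1) by omega, pow_add, ← mul_assoc,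
            ← mul_pow, PowerSeries.inv_mul_cancel Φ hne, one_pow, one_mul]
        have hzero := coeff_pow_mul_derivative Φ (d + 1) (2 * d + 1)
        have hfac : (2 * ((d + 1 : ℕ) : K) - ((2 * d + 1 : ℕ) + 1)) = 0 := by push_cast; ring
        have hfac' : ((2 * d + 1 : ℕ) : K) + 1 ≠ 0 := Nat.cast_add_one_ne_zero _
        rw [hfac, zero_mul] at hzero
        have hzero' := (mul_eq_zero.1 hzero).resolve_left hfac'
        rw [show ∀ c : PowerSeries K, c * (X ^ h * Φ⁻¹ ^ (2 * h - 1)) * (Φ ^ (2 * (h + d)) * D) =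
            c * (X ^ h * (Φ⁻¹ ^ (2 * h - 1) * Φ ^ (2 * (h + d)) * D)) from fun c => by ring,
          hcancel, coeff_C_mul, add_assoc, coeff_X_pow_mul', if_pos (Nat.le_add_right h _),
          Nat.add_sub_cancel_left, hzero', mul_zero]
      have h0 := coeff_pow_mul_derivative Φ (n + 1) (2 * n)
      have h1 := coeff_pow_mul_derivative Φ (n + 1) (2 * n + 1)
      have hfac1 : (2 * ((n + 1 : ℕ) : K) - ((2 * n + 1 : ℕ) + 1)) = 0 := by push_cast; ring
      have hfac1' : ((2 * n + 1 : ℕ) : K) + 1 ≠ 0 := Nat.cast_add_one_ne_zero _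
      rw [hfac1, zero_mul] at h1
      have h1' := (mul_eq_zero.1 h1).resolve_left hfac1'
      have hfac0 : ((2 * n : ℕ) : K) + 1 ≠ 0 := Nat.cast_add_one_ne_zero _
      rw [hR, add_mul, sum_mul, map_add, map_sum, sum_eq_zero hterm, add_zero, sub_mul, one_mul,
        map_sub, ← mul_assoc, ← pow_succ', h1', sub_zero]
      have hden : (2 * ((n + 1 : ℕ) : K) - 1) = ((2 * n : ℕ) : K) + 1 := by push_cast; ring
      rw [hden, eq_div_iff hfac0, mul_comm, h0]
      push_cast
      ring
    intro i hi
    rw [← insert_Icc_right_eq_Icc_add_one (by omega), sum_insert (by simp), add_left_comm,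
      ← hR, map_add, coeff_C_mul, coeff_X_pow_mul']
    rcases Nat.lt_succ_iff_lt_or_eq.1 hi with hlt | rfl
    · rw [if_neg (by omega), mul_zero, zero_add, ih i hlt]
    · rw [if_pos le_rfl, Nat.sub_self, coeff_zero_eq_constantCoeff_apply, map_pow constantCoeff,
        PowerSeries.constantCoeff_inv, hΦ, inv_one, one_pow, mul_one]
      rw [hleft] at hright
      rw [show 2 * (n + 1) - 1 = 2 * n + 1 by omega]
      linear_combination -hright

end DoubleScaling

/-! ### Lagrange coefficients as sums over partitions -/

namespace DoubleScaling

open PowerSeries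

lemma coeff_pow_eq_sum_partitionsWithParts {B : PowerSeries ℝ} (hB : constantCoeff B = 0)
    (h m : ℕ) :
    coeff h (B ^ m) = (m ! : ℝ) * ∑ ν ∈ partitionsWithParts h m,
      ∏ k ∈ Icc 1 h, 1 / ((ν k)! : ℝ) * coeff k B ^ ν k := by
  have htrunc : ((trunc (h + 1) B : Polynomial ℝ) : PowerSeries ℝ) =
      ∑ k ∈ Icc 1 h, C (coeff k B) * X ^ k := by
    ext d
    have hb : ∀ k, coeff d (C (coeff k B) * X ^ k) = if d = k then coeff k B else 0 := fun k => by
      rw [coeff_C_mul, coeff_X_pow, mul_ite, mul_one, mul_zero]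
    rw [Polynomial.coeff_coe, coeff_trunc, map_sum]
    simp only [hb, sum_ite_eq, mem_Icc]
    rcases Nat.eq_zero_or_pos d with rfl | hd
    · simp [hB]
    · simp [Nat.one_le_iff_ne_zero, hd.ne']
  have hpow : coeff h (B ^ m) =
      coeff h (((trunc (h + 1) B : Polynomial ℝ) : PowerSeries ℝ) ^ m) := by
    rw [← coeff_coe_trunc_of_lt h.lt_succ_self, ← trunc_trunc_pow,
      coeff_coe_trunc_of_lt h.lt_succ_self]
  rw [hpow, htrunc, sum_pow_eq_sum_piAntidiag, map_sum, partitionsWithParts, sum_filter, mul_sum]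
  refine sum_congr rfl fun ν hν => ?_
  have hprod : ∏ k ∈ Icc 1 h, (C (coeff k B) * X ^ k) ^ ν k =
      C (∏ k ∈ Icc 1 h, coeff k B ^ ν k) * X ^ (∑ k ∈ Icc 1 h, k * ν k) := by
    simp only [mul_pow, prod_mul_distrib, ← pow_mul, prod_pow_eq_pow_sum, map_prod, map_pow]
  have hmult : ((∏ k ∈ Icc 1 h, (ν k)! : ℕ) : ℝ) * (Nat.multinomial (Icc 1 h) ν : ℝ) = m ! := by
    rw [← (mem_piAntidiag.1 hν).1]
    exact_mod_cast Nat.multinomial_spec (Icc 1 h) ν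
  have hne : ((∏ k ∈ Icc 1 h, (ν k)! : ℕ) : ℝ) ≠ 0 := by
    exact_mod_cast (prod_pos fun k _ => Nat.factorial_pos (ν k)).ne'
  have hnat : (Nat.multinomial (Icc 1 h) ν : PowerSeries ℝ) =
      C (Nat.multinomial (Icc 1 h) ν : ℝ) := by simp
  rw [hprod, hnat, coeff_C_mul, coeff_C_mul, coeff_X_pow]
  by_cases hs : ∑ k ∈ Icc 1 h, k * ν k = h
  · rw [if_pos hs.symm, if_pos hs, mul_one, prod_mul_distrib, prod_div_distrib, prod_const_one,
      ← hmult]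
    push_cast at hne ⊢
    field_simp
  · rw [if_neg (Ne.symm hs), if_neg hs, mul_zero, mul_zero, mul_zero]

lemma coeff_one_sub_two_mul_pow {B : PowerSeries ℝ} (hB : constantCoeff B = 0) {h : ℕ}
    (hh : 1 ≤ h) {N : ℕ} (hN : h ≤ N) :
    coeff h ((1 - 2 * B) ^ N) =
      ∑ m ∈ Icc 1 h, (-2 : ℝ) ^ m * (N.choose m : ℝ) * coeff h (B ^ m) := by
  have hterm : ∀ m, coeff h ((-2 * B) ^ m * 1 ^ (N - m) * (N.choose m : PowerSeries ℝ)) =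
      (-2 : ℝ) ^ m * (N.choose m : ℝ) * coeff h (B ^ m) := by
    intro m
    have : (-2 * B) ^ m * 1 ^ (N - m) * (N.choose m : PowerSeries ℝ) =
        C ((-2 : ℝ) ^ m * (N.choose m : ℝ)) * B ^ m := by
      have h2 : (2 : PowerSeries ℝ) = C (2 : ℝ) := (map_ofNat C 2).symm
      rw [map_mul, map_pow, map_neg, ← h2, map_natCast, one_pow, mul_pow]
      ring
    rw [this, coeff_C_mul]
  have hbin : (1 - 2 * B) ^ N = (-2 * B + 1) ^ N := by ring
  rw [hbin, add_pow, map_sum, sum_congr rfl fun m _ => hterm m]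
  symm
  refine sum_subset (fun m hm => ?_) fun m _ hm => ?_
  · have := mem_Icc.1 hm
    exact mem_range.2 (by omega)
  · suffices coeff h (B ^ m) = 0 by rw [this, mul_zero]
    rcases Nat.eq_zero_or_pos m with rfl | h0
    · rw [pow_zero, coeff_one, if_neg (by omega)]
    · have hlt : h < m := by
        by_contra hle
        exact hm (mem_Icc.2 ⟨h0, not_lt.1 hle⟩)
      exact X_pow_dvd_iff.1 (pow_dvd_pow_of_dvd (X_dvd_iff.2 hB) m) h hlt

/-- Lagrange coefficients of `φ = (1 - 2 B)²` as sums over partitions. -/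
lemma lagrange_coeff_eq_sum_partitions {B : PowerSeries ℝ} (hB : constantCoeff B = 0) {h : ℕ}
    (hh : 1 ≤ h) :
    -2 ^ (2 * h - 2) * (coeff h (((1 - 2 * B) ^ 2) ^ (2 * h - 1)) / (2 * h - 1)) =
      ((4 * h - 3)! : ℝ) * ∑ m ∈ Icc 1 h,
        (-1 : ℝ) ^ (m - 1) * 2 ^ (m + 2 * h - 1) / ((4 * h - 2 - m)! : ℝ) *
          ∑ ν ∈ partitionsWithParts h m, ∏ k ∈ Icc 1 h, 1 / ((ν k)! : ℝ) * coeff k B ^ ν k := by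
  obtain ⟨j, rfl⟩ := Nat.exists_eq_add_of_le' hh
  rw [← pow_mul, show 2 * (2 * (j + 1) - 1) = 4 * (j + 1) - 2 by omega,
    coeff_one_sub_two_mul_pow hB hh (by omega), sum_div, mul_sum, mul_sum]
  refine sum_congr rfl fun m hm => ?_
  obtain ⟨h1, h2⟩ := mem_Icc.1 hm
  rw [coeff_pow_eq_sum_partitionsWithParts hB]
  obtain ⟨i, rfl⟩ := Nat.exists_eq_add_of_le' h1
  have hch := Nat.choose_mul_factorial_mul_factorial
    (show i + 1 ≤ 4 * (j + 1) - 2 by omega)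
  have hfac : (4 * (j + 1) - 2)! = (4 * (j + 1) - 2) * (4 * (j + 1) - 3)! := by
    rw [show 4 * (j + 1) - 2 = (4 * (j + 1) - 3) + 1 by omega, Nat.factorial_succ]
  rw [hfac] at hch
  have hchR : (((4 * (j + 1) - 2).choose (i + 1) : ℕ) : ℝ) * ((i + 1)! : ℝ) *
      ((4 * (j + 1) - 2 - (i + 1))! : ℝ) = (4 * j + 2) * ((4 * (j + 1) - 3)! : ℝ) := by
    rw [show 4 * (j + 1) - 2 = 4 * j + 2 by omega] at hch ⊢
    exact_mod_cast hch
  have hne : ((4 * (j + 1) - 2 - (i + 1))! : ℝ) ≠ 0 := by positivity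
  have hden : (2 * ((j + 1 : ℕ) : ℝ) - 1) = 2 * j + 1 := by push_cast; ring
  have hden' : (2 * (j : ℝ) + 1) ≠ 0 := by positivity
  rw [hden, show i + 1 - 1 = i by omega, show i + 1 + 2 * (j + 1) - 1 = i + 2 * j + 2 by omega,
    show 2 * (j + 1) - 2 = 2 * j by omega, neg_pow (2 : ℝ)]
  rw [← eq_div_iff hne] at hchR
  generalize ((4 * (j + 1) - 2 - (i + 1))! : ℝ) = D at hne hchR ⊢
  generalize ∑ ν ∈ partitionsWithParts (j + 1) (i + 1),
    ∏ k ∈ Icc 1 (j + 1), 1 / ((ν k)! : ℝ) * coeff k B ^ ν k = S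
  calc _ = (-1) ^ i * 2 ^ (i + 2 * j + 1) *
        ((((4 * (j + 1) - 2).choose (i + 1) : ℕ) : ℝ) * ((i + 1)! : ℝ)) * S / (2 * j + 1) := by ring
    _ = _ := by
      rw [hchR]
      field_simp
      ring

end DoubleScaling

/-! ### The Sommerfeld expansion -/

namespace DoubleScaling

open Real MeasureTheory Topology

/-- Taylor expansion of the truncated power `(1 + ρ)_+^α` with a remainder estimate that holds on
the whole line. -/
lemma exists_forall_abs_max_one_add_rpow_sub_le {α : ℝ} (hα : 0 < α) {N : ℕ} (hN : α ≤ N) :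
    ∃ C : ℝ, ∀ ρ : ℝ, |max (1 + ρ) 0 ^ α - ∑ j ∈ range N, Ring.choose α j * ρ ^ j| ≤
      C * |ρ| ^ N := by
  have h := (one_add_rpow_hasFPowerSeriesAt_zero (a := α)).isBigO_sub_partialSum_pow N
  obtain ⟨C₁, hC₁, hb⟩ := h.exists_pos
  obtain ⟨ε, hε, hball⟩ := Metric.eventually_nhds_iff.1 hb.bound
  set δ := min ε 1
  have hδ : 0 < δ := lt_min hε one_pos
  set S := ∑ j ∈ range N, |Ring.choose α j|
  have hS : 0 ≤ S := sum_nonneg fun _ _ => abs_nonneg _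
  refine ⟨C₁ + (2 ^ N + S) / δ ^ N, fun ρ => ?_⟩
  rw [add_mul]
  rcases lt_or_ge |ρ| δ with hlt | hge
  · have h1 := hball (y := ρ) (by simpa using hlt.trans_le (min_le_left _ _))
    have hpos : 0 ≤ 1 + ρ := by linarith [neg_abs_le ρ, hlt.trans_le (min_le_right ε 1)]
    have h2 : (binomialSeries ℝ α).partialSum N ρ = ∑ j ∈ range N, Ring.choose α j * ρ ^ j := by
      simp [FormalMultilinearSeries.partialSum, binomialSeries, mul_comm]
    rw [h2, zero_add, norm_pow, norm_norm, norm_eq_abs, norm_eq_abs] at h1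
    rw [max_eq_left hpos]
    have : 0 ≤ (2 ^ N + S) / δ ^ N * |ρ| ^ N := by positivity
    linarith
  · set s := |ρ| / δ
    have hs : 1 ≤ s := (one_le_div hδ).2 hge
    have hρs : |ρ| ≤ s := le_div_self (abs_nonneg ρ) hδ (min_le_right _ _)
    have h1 : |max (1 + ρ) 0 ^ α| ≤ 2 ^ N * s ^ N := by
      rw [abs_of_nonneg (rpow_nonneg (le_max_right _ _) _), ← mul_pow, ← rpow_natCast]
      calc max (1 + ρ) 0 ^ α ≤ (2 * s) ^ α := by
            refine rpow_le_rpow (le_max_right _ _) (max_le ?_ (by linarith)) hα.le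
            linarith [le_abs_self ρ]
        _ ≤ (2 * s) ^ (N : ℝ) := rpow_le_rpow_of_exponent_le (by linarith) hN
    have h2 : |∑ j ∈ range N, Ring.choose α j * ρ ^ j| ≤ S * s ^ N := by
      rw [sum_mul]
      refine (abs_sum_le_sum_abs _ _).trans (sum_le_sum fun j hj => ?_)
      rw [abs_mul, abs_pow]
      refine mul_le_mul_of_nonneg_left ?_ (abs_nonneg _)
      exact (pow_le_pow_left₀ (abs_nonneg _) hρs j).trans
        (pow_le_pow_right₀ hs (mem_range.1 hj).le)
    have h3 : (2 ^ N + S) / δ ^ N * |ρ| ^ N = 2 ^ N * s ^ N + S * s ^ N := by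
      simp only [s, div_pow]
      ring
    rw [h3]
    have := abs_sub (max (1 + ρ) 0 ^ α) (∑ j ∈ range N, Ring.choose α j * ρ ^ j)
    have : 0 ≤ C₁ * |ρ| ^ N := by positivity
    linarith

/-- The coefficients in `(π / (2 x))²` of the Sommerfeld expansion of
`Γ(α + 1) x ^ (-α) * fermiDirac α x`. -/
noncomputable def sommerfeldSeries (α : ℝ) : PowerSeries ℝ :=
  PowerSeries.mk fun k => Ring.choose α (2 * k) *
    (∫ r : ℝ, r ^ (2 * k) * logisticDensity r) * (2 / π) ^ (2 * k)

lemma sum_range_two_mul {M : Type*} [AddCommMonoid M] (a : ℕ → M) (n : ℕ) :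
    ∑ j ∈ range (2 * n), a j = ∑ i ∈ range n, (a (2 * i) + a (2 * i + 1)) := by
  induction n with
  | zero => simp
  | succ n ih =>
    rw [mul_add, mul_one, sum_range_succ, sum_range_succ, ih, sum_range_succ, add_assoc]

lemma tendsto_pi_div_sq : Tendsto (fun x : ℝ => (π / (2 * x)) ^ 2) atTop (𝓝 0) := by
  have : Tendsto (fun x : ℝ => π / (2 * x)) atTop (𝓝 0) :=
    tendsto_const_nhds.div_atTop (tendsto_id.const_mul_atTop two_pos)
  simpa using this.pow 2

/-- The Sommerfeld expansion: integrate the Taylor expansion of `(1 + r / x)_+^α` against the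
logistic density. Since the remainder estimate is global, no tail has to be cut off. -/
lemma hasAsymptoticExpansion_fermiDirac {α : ℝ} (hα : 0 < α) (hα2 : α ≤ 2) :
    HasAsymptoticExpansion atTop (fun x => (π / (2 * x)) ^ 2)
      (fun x => Gamma (α + 1) * fermiDirac α x / x ^ α) (sommerfeldSeries α) := by
  have main : ∀ n : ℕ, (fun x => Gamma (α + 1) * fermiDirac α x / x ^ α -
      (PowerSeries.trunc (n + 1) (sommerfeldSeries α)).eval ((π / (2 * x)) ^ 2)) =O[atTop]
        fun x => ((π / (2 * x)) ^ 2) ^ (n + 1) := by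
    intro n
    obtain ⟨C, hC⟩ := exists_forall_abs_max_one_add_rpow_sub_le hα (N := 2 * (n + 1))
      (by push_cast; linarith [n.cast_nonneg (α := ℝ)])
    set M := ∫ r : ℝ, |r| ^ (2 * (n + 1)) * logisticDensity r
    refine IsBigO.of_bound (C * M * (2 / π) ^ (2 * (n + 1))) ?_
    filter_upwards [eventually_gt_atTop 0] with x hx
    have hterm : ∀ j, Integrable fun r : ℝ =>
        Ring.choose α j * (r / x) ^ j * logisticDensity r := fun j => by
      refine ((integrable_pow_mul_logisticDensity j).const_mul (Ring.choose α j / x ^ j)).congr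
        (ae_of_all _ fun r => ?_)
      simp only [div_pow]
      ring
    have hpoly : ∫ r : ℝ, (∑ j ∈ range (2 * (n + 1)), Ring.choose α j * (r / x) ^ j) *
        logisticDensity r =
        (PowerSeries.trunc (n + 1) (sommerfeldSeries α)).eval ((π / (2 * x)) ^ 2) := by
      simp only [sum_mul]
      rw [integral_finsetSum _ fun j _ => hterm j, sum_range_two_mul, eval_trunc_eq_sum]
      have hj : ∀ j, ∫ r : ℝ, Ring.choose α j * (r / x) ^ j * logisticDensity r =
          Ring.choose α j / x ^ j * ∫ r : ℝ, r ^ j * logisticDensity r := fun j => by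
        rw [← integral_const_mul]
        congr with r
        rw [div_pow]
        ring
      refine sum_congr rfl fun i _ => ?_
      rw [hj, hj, integral_odd_pow_mul_logisticDensity ⟨i, rfl⟩, mul_zero, add_zero,
        sommerfeldSeries, PowerSeries.coeff_mk, ← pow_mul, mul_assoc _ ((2 / π) ^ _), ← mul_pow]
      have : 2 / π * (π / (2 * x)) = 1 / x := by field_simp
      rw [this, one_div_pow]
      ring
    have hint : Integrable fun r : ℝ =>
        (∑ j ∈ range (2 * (n + 1)), Ring.choose α j * (r / x) ^ j) * logisticDensity r := by
      simp only [sum_mul]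
      exact integrable_finsetSum _ fun j _ => hterm j
    have hbound : ∀ r : ℝ, ‖max (1 + r / x) 0 ^ α * logisticDensity r -
        (∑ j ∈ range (2 * (n + 1)), Ring.choose α j * (r / x) ^ j) * logisticDensity r‖ ≤
        C / x ^ (2 * (n + 1)) * (|r| ^ (2 * (n + 1)) * logisticDensity r) := by
      intro r
      rw [← sub_mul, norm_mul, norm_of_nonneg (logisticDensity_pos r).le, norm_eq_abs]
      refine (mul_le_mul_of_nonneg_right (hC (r / x)) (logisticDensity_pos r).le).trans_eq ?_
      rw [abs_div, abs_of_pos hx, div_pow]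
      ring
    have hbint := (integrable_abs_pow_mul_logisticDensity (2 * (n + 1))).const_mul
      (C / x ^ (2 * (n + 1)))
    have hmeas : Measurable fun r : ℝ => max (1 + r / x) 0 ^ α * logisticDensity r := by
      have := continuous_logisticDensity.measurable
      fun_prop
    have hdiff := hbint.mono' (hmeas.aestronglyMeasurable.sub hint.aestronglyMeasurable)
      (ae_of_all _ hbound)
    have hmax : Integrable fun r : ℝ => max (1 + r / x) 0 ^ α * logisticDensity r := by
      simpa using hdiff.add hint
    have hscale : Gamma (α + 1) * fermiDirac α x / x ^ α =
        ∫ r : ℝ, max (1 + r / x) 0 ^ α * logisticDensity r := by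
      rw [Gamma_mul_fermiDirac_eq_integral_max hα, div_eq_iff (rpow_pos_of_pos hx α).ne',
        ← integral_mul_const]
      congr with r
      have : max (x + r) 0 = max (1 + r / x) 0 * x := by
        rw [max_mul_of_nonneg _ _ hx.le, zero_mul, add_mul, one_mul, div_mul_cancel₀ _ hx.ne']
      rw [this, mul_rpow (le_max_right _ _) hx.le]
      ring
    rw [hscale, ← hpoly, ← integral_sub hmax hint]
    refine (norm_integral_le_of_norm_le hbint (ae_of_all _ hbound)).trans_eq ?_
    rw [integral_const_mul, ← pow_mul, norm_of_nonneg (by positivity), mul_assoc (C * M), ← mul_pow]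
    have : 2 / π * (π / (2 * x)) = 1 / x := by field_simp
    rw [this, one_div_pow]
    ring
  intro n
  cases n with
  | succ n => exact main n
  | zero =>
    have h0 := (main 0).trans_tendsto (by simpa using tendsto_pi_div_sq)
    have h1 := (h0.add_const (PowerSeries.coeff 0 (sommerfeldSeries α))).isBigO_one ℝ
    simpa [eval_trunc_eq_sum] using h1

end DoubleScaling

/-! ### Coefficients of the Sommerfeld expansion of order `1/2` -/

namespace DoubleScaling

open Real MeasureTheory Topology

lemma choose_succ_eq (a : ℝ) (n : ℕ) :
    Ring.choose a (n + 1) = Ring.choose a n * (a - n) / (n + 1) := by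
  rw [Ring.choose_eq_smul, Ring.choose_eq_smul, descPochhammer_succ_right, Polynomial.smeval_mul,
    Polynomial.smeval_sub, Polynomial.smeval_X, Polynomial.smeval_natCast, Nat.factorial_succ]
  simp
  field_simp

lemma choose_one_half_even {k : ℕ} (hk : k ≠ 0) :
    Ring.choose (1 / 2 : ℝ) (2 * k) = -((4 * k - 3)‼ : ℝ) / (2 ^ (2 * k) * (2 * k)!) := by
  obtain ⟨j, rfl⟩ := Nat.exists_eq_succ_of_ne_zero hk
  rw [show 4 * j.succ - 3 = 4 * j + 1 by omega]
  clear hk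
  induction j with
  | zero =>
    simp only [Nat.succ_eq_add_one, zero_add, mul_one, choose_succ_eq]
    norm_num [choose_succ_eq, Nat.factorial, Nat.doubleFactorial]
  | succ j ih =>
    rw [show 2 * (j + 1).succ = 2 * j.succ + 1 + 1 by omega, choose_succ_eq, choose_succ_eq, ih,
      show 4 * (j + 1) + 1 = 4 * j + 1 + 2 + 2 by ring, Nat.doubleFactorial_add_two,
      Nat.doubleFactorial_add_two, Nat.factorial_succ (2 * j.succ + 1),
      Nat.factorial_succ (2 * j.succ)]
    push_cast
    field_simp
    ring

/-- The generating series of the weights attached to the parts of the partitions: the Sommerfeld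
expansion of order `1/2` is `1 - 2 * bernoulliWeightSeries`. -/
noncomputable def bernoulliWeightSeries : PowerSeries ℝ :=
  PowerSeries.mk fun k => ((2 : ℝ) ^ (2 * k - 1) - 1) * ((4 * k - 3)‼ : ℝ) *
    |(bernoulli (2 * k) : ℝ)| / ((2 * k)! : ℝ)

lemma constantCoeff_bernoulliWeightSeries :
    PowerSeries.constantCoeff bernoulliWeightSeries = 0 := by
  simp [← PowerSeries.coeff_zero_eq_constantCoeff_apply, bernoulliWeightSeries]

lemma constantCoeff_sommerfeldSeries (α : ℝ) :
    PowerSeries.constantCoeff (sommerfeldSeries α) = 1 := by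
  simp [← PowerSeries.coeff_zero_eq_constantCoeff_apply, sommerfeldSeries, integral_logisticDensity]

lemma sommerfeldSeries_one_half : sommerfeldSeries (1 / 2) = 1 - 2 * bernoulliWeightSeries := by
  ext k
  have h2 : (2 : PowerSeries ℝ) = PowerSeries.C (2 : ℝ) := (map_ofNat PowerSeries.C 2).symm
  rcases eq_or_ne k 0 with rfl | hk
  · simp [constantCoeff_sommerfeldSeries, constantCoeff_bernoulliWeightSeries]
  · rw [map_sub, PowerSeries.coeff_one, if_neg hk, h2, PowerSeries.coeff_C_mul, sommerfeldSeries,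
      bernoulliWeightSeries, PowerSeries.coeff_mk, PowerSeries.coeff_mk, choose_one_half_even hk,
      integral_even_pow_mul_logisticDensity hk, div_pow]
    field_simp
    ring

/-! ### Existence and uniqueness of the saddle point -/

lemma Gamma_three_halves : Gamma (1 / 2 + 1) = √π / 2 := by
  rw [Gamma_add_one (by norm_num), Gamma_one_half_eq]
  ring

lemma Gamma_five_halves : Gamma (3 / 2 + 1) = 3 * √π / 4 := by
  rw [Gamma_add_one (by norm_num), show (3 / 2 : ℝ) = 1 / 2 + 1 by norm_num, Gamma_three_halves]
  ring

lemma tendsto_fermiDirac_atTop {α : ℝ} (hα : 0 < α) (hα2 : α ≤ 2) :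
    Tendsto (fermiDirac α) atTop atTop := by
  have h := (hasAsymptoticExpansion_fermiDirac hα hα2).tendsto tendsto_pi_div_sq
  rw [constantCoeff_sommerfeldSeries] at h
  have hΓ := Gamma_pos_of_pos (add_pos hα one_pos)
  refine ((h.pos_mul_atTop one_pos (tendsto_rpow_atTop hα)).const_mul_atTop
    (inv_pos.2 hΓ)).congr' ?_
  filter_upwards [eventually_gt_atTop 0] with x hx
  have := rpow_pos_of_pos hx α
  field_simp

lemma exists_fermiDirac_eq {α : ℝ} (hα : 0 < α) (hα2 : α ≤ 2) {s : ℝ} (hs : 0 < s) :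
    ∃ x, fermiDirac α x = s := by
  obtain ⟨a, ha⟩ := ((tendsto_fermiDirac_atBot hα).eventually_lt_const hs).exists
  obtain ⟨b, hb⟩ := ((tendsto_fermiDirac_atTop hα hα2).eventually_ge_atTop s).exists
  exact mem_range_of_exists_le_of_exists_ge (continuous_fermiDirac hα) ⟨a, ha.le⟩ ⟨b, hb⟩

lemma Li_neg_nonneg {α : ℝ} (hα : 0 < α) {z : ℝ} (hz : -1 < z) (hz0 : z ≤ 0) : 0 ≤ Li α (-z) := by
  refine mul_nonneg (div_nonneg (by linarith) (Gamma_pos_of_pos hα).le) ?_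
  refine setIntegral_nonneg measurableSet_Ioi fun t ht => ?_
  have := one_lt_exp_iff.2 (Set.mem_Ioi.1 ht)
  exact div_nonneg (rpow_nonneg (le_of_lt ht) _) (by linarith)

lemma pos_of_Li_neg_eq_neg {α : ℝ} (hα : 0 < α) {z s : ℝ} (hs : 0 < s) (hz : -1 < z)
    (h : Li α (-z) = -s) : 0 < z := by
  by_contra hz0
  linarith [Li_neg_nonneg hα hz (not_lt.1 hz0)]

lemma Li_neg_of_pos (α : ℝ) {z : ℝ} (hz : 0 < z) : Li α (-z) = -fermiDirac α (log z) := by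
  rw [← Li_neg_exp, exp_log hz]

lemma existsUnique_saddlePoint {μ : ℝ} (hμ : 0 < μ) :
    ∃! z : ℝ, -1 < z ∧ Li (1 / 2) (-z) = -√μ := by
  have hs := sqrt_pos.2 hμ
  have hα : (0 : ℝ) < 1 / 2 := by norm_num
  obtain ⟨x, hx⟩ := exists_fermiDirac_eq hα (by norm_num) hs
  refine ⟨exp x, ⟨by linarith [exp_pos x], by rw [Li_neg_exp, hx]⟩, ?_⟩
  rintro z ⟨hz, h⟩
  have hz0 := pos_of_Li_neg_eq_neg hα hs hz h
  rw [Li_neg_of_pos _ hz0, neg_inj, ← hx] at h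
  rw [← (strictMono_fermiDirac hα).injective h, exp_log hz0]

lemma saddlePoint_spec {μ : ℝ} (hμ : 0 < μ) :
    0 < saddlePoint μ ∧ fermiDirac (1 / 2) (log (saddlePoint μ)) = √μ := by
  obtain ⟨z, ⟨hz, h⟩, -⟩ := existsUnique_saddlePoint hμ
  have hex : ∃ a ∈ Set.Ioi (-1 : ℝ), (fun z : ℝ => Li (1 / 2) (-z)) a = -√μ := ⟨z, hz, h⟩
  have h1 : -1 < saddlePoint μ := Function.invFunOn_mem hex
  have h2 : Li (1 / 2) (-saddlePoint μ) = -√μ := Function.invFunOn_eq hex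
  have h0 := pos_of_Li_neg_eq_neg (by norm_num) (sqrt_pos.2 hμ) h1 h2
  exact ⟨h0, by rwa [Li_neg_of_pos _ h0, neg_inj] at h2⟩

lemma tendsto_log_saddlePoint : Tendsto (fun μ => log (saddlePoint μ)) atTop atTop := by
  refine tendsto_atTop.2 fun M => ?_
  filter_upwards [eventually_gt_atTop 0,
    tendsto_sqrt_atTop.eventually_ge_atTop (fermiDirac (1 / 2) M)] with μ hμ hM
  rw [← (saddlePoint_spec hμ).2] at hM
  exact (strictMono_fermiDirac (by norm_num)).le_iff_le.1 hM

/-! ### The action at the saddle point -/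

/-- The free energy multiplied by `√μ / N`, as a function of the logarithm `x` of the saddle
point, so that `√μ = fermiDirac (1 / 2) x`. -/
noncomputable def scaledAction (x : ℝ) : ℝ :=
  π / 12 * fermiDirac (1 / 2) x ^ 3 - fermiDirac (1 / 2) x * x + fermiDirac (3 / 2) x

lemma action_saddlePoint {μ : ℝ} (hμ : 0 < μ) :
    action (saddlePoint μ) μ = scaledAction (log (saddlePoint μ)) / √μ := by
  obtain ⟨h0, h⟩ := saddlePoint_spec hμ
  have hs := sqrt_pos.2 hμ
  have hsq := sq_sqrt hμ.le
  rw [action, Li_neg_of_pos _ h0, scaledAction, h]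
  generalize fermiDirac (3 / 2) (log (saddlePoint μ)) = G
  generalize √μ = s at hs hsq ⊢
  rw [← hsq]
  field_simp
  ring

/-- The leading terms, of order `x ^ (3 / 2)`, cancel. -/
lemma tendsto_scaledAction : Tendsto scaledAction atTop (𝓝 0) := by
  have hT := tendsto_pi_div_sq
  have h1 := hasAsymptoticExpansion_fermiDirac (α := 1 / 2) (by norm_num) (by norm_num)
  have h3 := hasAsymptoticExpansion_fermiDirac (α := 3 / 2) (by norm_num) (by norm_num)
  have hs : 0 < √π := sqrt_pos.2 pi_pos
  have hO := (((h1.pow hT 3).const_mul hT (2 / (3 * √π))).add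
    ((h1.const_mul hT (-(2 / √π))).add (h3.const_mul hT (4 / (3 * √π))))).isBigO_pow (n := 1) (by
      intro i hi
      obtain rfl : i = 0 := by omega
      simp only [PowerSeries.coeff_zero_eq_constantCoeff_apply, map_add, map_mul, map_pow,
        PowerSeries.constantCoeff_C, constantCoeff_sommerfeldSeries]
      field_simp
      norm_num)
  have hmul := hO.mul (isBigO_refl (fun x : ℝ => x ^ (3 / 2 : ℝ)) atTop)
  have hlim : Tendsto (fun x : ℝ => ((π / (2 * x)) ^ 2) ^ 1 * x ^ (3 / 2 : ℝ)) atTop (𝓝 0) := by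
    have h := (tendsto_rpow_neg_atTop (y := 1 / 2) (by norm_num)).const_mul ((π / 2) ^ 2)
    rw [mul_zero] at h
    refine h.congr' ?_
    filter_upwards [eventually_gt_atTop 0] with x hx
    have : x ^ (3 / 2 : ℝ) = x ^ (-(1 / 2) : ℝ) * x ^ 2 := by
      rw [← rpow_natCast, ← rpow_add hx]
      norm_num
    rw [this]
    field_simp
  refine (hmul.trans_tendsto hlim).congr' ?_
  filter_upwards [eventually_gt_atTop 0] with x hx
  have hx2 : x ^ (1 / 2 : ℝ) = √x := (sqrt_eq_rpow x).symm
  have hx3 : x ^ (3 / 2 : ℝ) = x * √x := by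
    rw [show (3 / 2 : ℝ) = 1 + 1 / 2 by norm_num, rpow_add hx, rpow_one, hx2]
  rw [scaledAction, Gamma_three_halves, Gamma_five_halves, hx2, hx3]
  have hsx := sqrt_pos.2 hx
  have e1 := sq_sqrt hx.le
  have e2 := sq_sqrt pi_pos.le
  generalize √x = y at *
  generalize √π = p at *
  rw [← e1, ← e2]
  field_simp
  ring

/-! ### Expansion of the saddle point -/

/-- The coefficients in the expansion `x = π (μ / 4 + ∑ h, saddleCoeff h / μ^(2h-1))` of the
logarithm of the saddle point, as Lagrange inversion gives them. -/
noncomputable def saddleCoeff (h : ℕ) : ℝ :=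
  -2 ^ (2 * h - 2) *
    (PowerSeries.coeff h (((1 - 2 * bernoulliWeightSeries) ^ 2) ^ (2 * h - 1)) / (2 * h - 1))

/-- The expansion of the logarithm `x` of the saddle point in powers of
`√μ = fermiDirac (1 / 2) x`. -/
lemma isBigO_saddle_expansion (n : ℕ) :
    (fun x => π / 4 * fermiDirac (1 / 2) x ^ 2 - x +
      π * ∑ h ∈ Icc 1 n, saddleCoeff h / fermiDirac (1 / 2) x ^ (4 * h - 2)) =O[atTop]
      fun x => 1 / fermiDirac (1 / 2) x ^ (4 * n + 2) := by
  have hT := tendsto_pi_div_sq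
  have hα : (0 : ℝ) < 1 / 2 := by norm_num
  have h1 := hasAsymptoticExpansion_fermiDirac (α := 1 / 2) hα (by norm_num)
  rw [sommerfeldSeries_one_half] at h1
  have hφ := (h1.pow hT 2).congr' (g := fun x => π / 4 * fermiDirac (1 / 2) x ^ 2 / x) (by
    filter_upwards [eventually_gt_atTop 0] with x hx
    rw [Gamma_three_halves, ← sqrt_eq_rpow, div_pow, mul_pow, div_pow, sq_sqrt hx.le,
      sq_sqrt pi_pos.le]
    norm_num)
  set Φ := (1 - 2 * bernoulliWeightSeries) ^ 2 with hΦ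
  have hΦ1 : PowerSeries.constantCoeff Φ = 1 := by
    simp [hΦ, constantCoeff_bernoulliWeightSeries]
  have hO := (((hasAsymptoticExpansion_const hT 1).add (hφ.const_mul hT (-1))).add
    (HasAsymptoticExpansion.sum hT (Icc 1 n) fun h _ =>
      (((hasAsymptoticExpansion_self hT).pow hT h).mul hT
        ((hφ.inv hT (by simp [hΦ1])).pow hT (2 * h - 1))).const_mul hT
          (PowerSeries.coeff h (Φ ^ (2 * h - 1)) / (2 * h - 1)))).isBigO_pow (n := n + 1) (by
    have := lagrange_inversion hΦ1 n
    simpa [sub_eq_add_neg] using this)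
  -- `φ = π μ / (4x)`, so multiplying by `-x` leaves only powers of `μ` next to the single term `-x`
  have hmul := (isBigO_refl (fun x : ℝ => -x) atTop).mul hO
  have hbd : (fun x : ℝ => -x * ((π / (2 * x)) ^ 2) ^ (n + 1)) =O[atTop]
      fun x => 1 / fermiDirac (1 / 2) x ^ (4 * n + 2) := by
    have hb := (((hφ.pow hT (2 * n + 1)).isBigO_one).mul (isBigO_refl
      (fun x => 1 / fermiDirac (1 / 2) x ^ (4 * n + 2)) atTop)).const_mul_left (-π * 2 ^ (2 * n))
    simp only [one_mul] at hb
    refine hb.congr' ?_ EventuallyEq.rfl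
    filter_upwards [eventually_gt_atTop 0] with x hx
    have hg := fermiDirac_pos hα x
    generalize fermiDirac (1 / 2) x = g at hg
    have h4 : (4 : ℝ) = 2 * 2 := by norm_num
    rw [show 4 * n + 2 = 2 * (2 * n + 1) by ring, h4]
    simp only [div_pow, mul_pow, ← pow_mul]
    field_simp
    ring
  refine (hmul.trans hbd).congr' ?_ EventuallyEq.rfl
  filter_upwards [eventually_gt_atTop 0] with x hx
  have hg := fermiDirac_pos hα x
  generalize fermiDirac (1 / 2) x = g at hg
  rw [mul_add, mul_sum, mul_sum]
  congr 1
  · field_simp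
    ring
  · refine sum_congr rfl fun h hh => ?_
    obtain ⟨j, rfl⟩ := Nat.exists_eq_add_of_le' (mem_Icc.1 hh).1
    rw [saddleCoeff, ← hΦ]
    generalize PowerSeries.coeff (j + 1) (Φ ^ (2 * (j + 1) - 1)) / (2 * ((j + 1 : ℕ) : ℝ) - 1) = c
    rw [show 4 * (j + 1) - 2 = 2 * (2 * j + 1) by omega,
      show 2 * (j + 1) - 1 = 2 * j + 1 by omega, show 2 * (j + 1) - 2 = 2 * j by omega]
    have h4 : (4 : ℝ) = 2 * 2 := by norm_num
    rw [h4]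
    simp only [div_pow, mul_pow, ← pow_mul, inv_div]
    field_simp
    ring

/-! ### Expansion of the free energy -/

lemma nonneg_of_antitone_of_tendsto {F F' : ℝ → ℝ} {a : ℝ} (hF : ∀ x, HasDerivAt F (F' x) x)
    (hF' : ∀ x, a ≤ x → F' x ≤ 0) (hlim : Tendsto F atTop (𝓝 0)) {x : ℝ} (hx : a ≤ x) :
    0 ≤ F x := by
  have hanti : AntitoneOn F (Set.Ici a) := by
    refine antitoneOn_of_deriv_nonpos (convex_Ici a)
      (fun y _ => (hF y).continuousAt.continuousWithinAt)
      (fun y _ => (hF y).differentiableAt.differentiableWithinAt) fun y hy => ?_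
    rw [interior_Ici] at hy
    rw [(hF y).deriv]
    exact hF' y (le_of_lt hy)
  refine le_of_tendsto hlim ?_
  filter_upwards [eventually_ge_atTop x] with y hy
  exact hanti hx (hx.trans hy) hy

/-- Integration of an asymptotic estimate for `dF/dg` when `F` vanishes at infinity. -/
lemma isBigO_of_hasDerivAt_mul {F R g g' : ℝ → ℝ} {m : ℕ} (hm : m ≠ 0)
    (hF : ∀ x, HasDerivAt F (g' x * R x) x) (hg : ∀ x, HasDerivAt g (g' x) x)
    (hg0 : ∀ x, 0 < g x) (hg' : ∀ x, 0 ≤ g' x) (hlim : Tendsto F atTop (𝓝 0))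
    (hginf : Tendsto g atTop atTop) (hR : R =O[atTop] fun x => 1 / g x ^ (m + 1)) :
    F =O[atTop] fun x => 1 / g x ^ m := by
  obtain ⟨C, -, hC⟩ := hR.exists_pos
  obtain ⟨a, ha⟩ := eventually_atTop.1 hC.bound
  have hm' : (m : ℝ) ≠ 0 := by exact_mod_cast hm
  have hpow : ∀ x, HasDerivAt (fun x => C / m * (1 / g x ^ m))
      (-(C * (g' x / g x ^ (m + 1)))) x := by
    intro x
    have h := (((hg x).pow m).inv (pow_pos (hg0 x) m).ne').const_mul (C / m)
    obtain ⟨k, rfl⟩ := Nat.exists_eq_succ_of_ne_zero hm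
    have := (hg0 x).ne'
    refine (h.congr_deriv ?_).congr_of_eventuallyEq (Eventually.of_forall fun y => by simp)
    simp only [Nat.succ_eq_add_one, Nat.add_sub_cancel, Pi.pow_apply] at hm' ⊢
    field_simp
    ring
  have hpowlim : Tendsto (fun x => C / m * (1 / g x ^ m)) atTop (𝓝 0) := by
    have := (tendsto_const_nhds (x := (1 : ℝ))).div_atTop ((tendsto_pow_atTop hm).comp hginf)
    simpa using this.const_mul (C / m)
  have hRabs : ∀ x, a ≤ x → |g' x * R x| ≤ C * (g' x / g x ^ (m + 1)) := by
    intro x hx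
    have h := ha x hx
    rw [norm_eq_abs, norm_of_nonneg (by have := hg0 x; positivity)] at h
    rw [abs_mul, abs_of_nonneg (hg' x)]
    refine (mul_le_mul_of_nonneg_left h (hg' x)).trans_eq ?_
    ring
  refine IsBigO.of_bound (C / m) ?_
  filter_upwards [eventually_ge_atTop a] with x hx
  rw [norm_eq_abs, norm_of_nonneg (by have := hg0 x; positivity), abs_le]
  constructor
  · have := nonneg_of_antitone_of_tendsto (fun x => (hpow x).fun_add (hF x))
      (fun y hy => by linarith [(abs_le.1 (hRabs y hy)).2]) (by simpa using hpowlim.add hlim) hx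
    linarith
  · have := nonneg_of_antitone_of_tendsto (fun x => (hpow x).fun_sub (hF x))
      (fun y hy => by linarith [(abs_le.1 (hRabs y hy)).1]) (by simpa using hpowlim.sub hlim) hx
    linarith

/-- Since `d(scaledAction)/d√μ = π μ / 4 - x`, the expansion of `x` integrates to one of the
action; there is no integration constant as both sides vanish at infinity. -/
lemma isBigO_scaledAction_expansion (n : ℕ) :
    (fun x => scaledAction x -
      π * ∑ h ∈ Icc 1 n, saddleCoeff h / (4 * h - 3) * (1 / fermiDirac (1 / 2) x ^ (4 * h - 3)))
      =O[atTop] fun x => 1 / fermiDirac (1 / 2) x ^ (4 * n + 1) := by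
  have hα : (0 : ℝ) < 1 / 2 := by norm_num
  have hg : ∀ x, HasDerivAt (fermiDirac (1 / 2)) (deriv (fermiDirac (1 / 2)) x) x := fun x =>
    (hasDerivAt_fermiDirac_integral hα x).differentiableAt.hasDerivAt
  have hG : ∀ x, HasDerivAt (fermiDirac (3 / 2)) (fermiDirac (1 / 2) x) x := fun x => by
    have := hasDerivAt_fermiDirac_add_one hα x
    rwa [show (1 / 2 + 1 : ℝ) = 3 / 2 by norm_num] at this
  have hg0 := fermiDirac_pos hα
  have hginf := tendsto_fermiDirac_atTop hα (by norm_num)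
  refine isBigO_of_hasDerivAt_mul (by omega) (fun x => ?_) hg hg0
    (fun x => (strictMono_fermiDirac hα).monotone.deriv_nonneg) ?_ hginf (isBigO_saddle_expansion n)
  · have hterm : ∀ h ∈ Icc 1 n, HasDerivAt
        (fun x => saddleCoeff h / (4 * h - 3) * (1 / fermiDirac (1 / 2) x ^ (4 * h - 3)))
        (-(deriv (fermiDirac (1 / 2)) x *
          (saddleCoeff h / fermiDirac (1 / 2) x ^ (4 * h - 2)))) x := by
      intro h hh
      obtain ⟨j, rfl⟩ := Nat.exists_eq_add_of_le' (mem_Icc.1 hh).1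
      have hd := (((hg x).pow (4 * (j + 1) - 3)).inv (pow_pos (hg0 x) _).ne').const_mul
        (saddleCoeff (j + 1) / (4 * ((j + 1 : ℕ) : ℝ) - 3))
      refine (hd.congr_deriv ?_).congr_of_eventuallyEq (Eventually.of_forall fun y => by simp)
      have hne := (hg0 x).ne'
      rw [show 4 * (j + 1) - 3 = 4 * j + 1 by omega, show 4 * (j + 1) - 2 = 4 * j + 2 by omega,
        show 4 * j + 1 - 1 = 4 * j by omega,
        show (4 * ((j + 1 : ℕ) : ℝ) - 3) = ((4 * j + 1 : ℕ) : ℝ) by push_cast; ring]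
      have hc : ((4 * j + 1 : ℕ) : ℝ) ≠ 0 := by positivity
      simp only [Pi.pow_apply]
      field_simp
      ring
    have hmain := (((((hg x).pow 3).const_mul (π / 12)).sub ((hg x).mul (hasDerivAt_id x))).add
      (hG x)).sub ((HasDerivAt.fun_sum hterm).const_mul π)
    refine hmain.congr_deriv ?_
    rw [sum_neg_distrib, ← mul_sum]
    simp only [id]
    ring
  · have hsum : Tendsto (fun x => π * ∑ h ∈ Icc 1 n,
        saddleCoeff h / (4 * h - 3) * (1 / fermiDirac (1 / 2) x ^ (4 * h - 3))) atTop
        (𝓝 (π * ∑ h ∈ Icc 1 n, saddleCoeff h / (4 * h - 3) * 0)) := by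
      refine (tendsto_finsetSum _ fun h hh => ?_).const_mul π
      have := (mem_Icc.1 hh).1
      exact (tendsto_const_nhds.div_atTop
        ((tendsto_pow_atTop (by omega)).comp hginf)).const_mul _
    simpa using tendsto_scaledAction.sub hsum

lemma isExpansion_of_eq_saddleCoeff (N : ℕ) {ξ : ℕ → ℝ}
    (hξ : ∀ h, 1 ≤ h → ξ (2 * h - 1) = saddleCoeff h) : IsExpansion N ξ := by
  intro n
  have h1 := (isBigO_scaledAction_expansion n).comp_tendsto tendsto_log_saddlePoint
  have h2 := (h1.mul (isBigO_refl (fun μ : ℝ => 1 / √μ) atTop)).const_mul_left (N : ℝ)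
  refine h2.congr' ?_ ?_
  · filter_upwards [eventually_gt_atTop 0] with μ hμ
    have hs := sqrt_pos.2 hμ
    simp only [Function.comp_apply]
    have hsum : ∑ h ∈ Icc 1 n, ξ (2 * h - 1) / (4 * (h : ℝ) - 3) * (1 / μ ^ (2 * h - 1)) =
        (∑ h ∈ Icc 1 n, saddleCoeff h / (4 * h - 3) * (1 / √μ ^ (4 * h - 3))) * (1 / √μ) := by
      rw [sum_mul]
      refine sum_congr rfl fun h hh => ?_
      obtain ⟨j, rfl⟩ := Nat.exists_eq_add_of_le' (mem_Icc.1 hh).1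
      have hpow : μ ^ (2 * (j + 1) - 1) = √μ ^ (4 * (j + 1) - 3) * √μ := by
        rw [← pow_succ, show 4 * (j + 1) - 3 + 1 = 2 * (2 * (j + 1) - 1) by omega, pow_mul,
          sq_sqrt hμ.le]
      rw [hξ _ (mem_Icc.1 hh).1, hpow]
      field_simp
    rw [(saddlePoint_spec hμ).2, freeEnergy, action_saddlePoint hμ, hsum]
    ring
  · filter_upwards [eventually_gt_atTop 0] with μ hμ
    simp only [Function.comp_apply]
    rw [(saddlePoint_spec hμ).2, one_div_mul_one_div, ← pow_succ,
      show 4 * n + 1 + 1 = 2 * (2 * n + 1) by omega, pow_mul, sq_sqrt hμ.le]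

lemma IsExpansion.unique {N : ℕ} (hN : 0 < N) {ξ ξ' : ℕ → ℝ} (h : IsExpansion N ξ)
    (h' : IsExpansion N ξ') : ∀ n, 1 ≤ n → ξ (2 * n - 1) = ξ' (2 * n - 1) := by
  intro n
  induction n using Nat.strong_induction_on with
  | _ n ih =>
    intro hn
    obtain ⟨j, rfl⟩ := Nat.exists_eq_add_of_le' hn
    set a : ℝ := π * N * ((ξ' (2 * (j + 1) - 1) - ξ (2 * (j + 1) - 1)) / (4 * (j + 1 : ℕ) - 3))
    have hdiff := ((h (j + 1)).sub (h' (j + 1))).mul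
      (isBigO_refl (fun μ : ℝ => μ ^ (2 * j + 1)) atTop)
    have hconst : (fun _ : ℝ => a) =O[atTop] fun μ : ℝ => 1 / μ ^ 2 := by
      refine hdiff.congr' ?_ ?_
      · filter_upwards [eventually_gt_atTop 0] with μ hμ
        have hsum : ∑ i ∈ Icc 1 j, ξ (2 * i - 1) / (4 * (i : ℝ) - 3) * (1 / μ ^ (2 * i - 1)) =
            ∑ i ∈ Icc 1 j, ξ' (2 * i - 1) / (4 * (i : ℝ) - 3) * (1 / μ ^ (2 * i - 1)) := by
          refine sum_congr rfl fun i hi => ?_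
          obtain ⟨hi1, hi2⟩ := mem_Icc.1 hi
          rw [ih i (by omega) hi1]
        rw [← insert_Icc_right_eq_Icc_add_one (by omega), sum_insert (by simp),
          sum_insert (by simp), hsum]
        simp only [a, show 2 * (j + 1) - 1 = 2 * j + 1 by omega]
        field_simp
        ring
      · filter_upwards [eventually_gt_atTop 0] with μ hμ
        rw [show 2 * (j + 1) + 1 = 2 * j + 1 + 2 by omega, pow_add]
        field_simp
    have hlim : Tendsto (fun μ : ℝ => 1 / μ ^ 2) atTop (𝓝 0) :=
      tendsto_const_nhds.div_atTop (tendsto_pow_atTop two_ne_zero)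
    have ha : a = 0 := tendsto_nhds_unique tendsto_const_nhds (hconst.trans_tendsto hlim)
    have hNpos : (N : ℝ) ≠ 0 := by exact_mod_cast hN.ne'
    have hden : (4 * ((j + 1 : ℕ) : ℝ) - 3) ≠ 0 := by
      push_cast
      have := j.cast_nonneg (α := ℝ)
      linarith
    have := (mul_eq_zero.1 ha).resolve_left (mul_ne_zero pi_pos.ne' hNpos)
    exact (sub_eq_zero.1 ((div_eq_zero_iff.1 this).resolve_right hden)).symm

end DoubleScaling

theorem theorem2 :
    (∀ μ : ℝ, 0 < μ → ∃! z : ℝ, -1 < z ∧ DoubleScaling.Li (1 / 2) (-z) = -√μ) ∧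
    ∀ (N : ℕ), 0 < N → ∀ ξ : ℕ → ℝ,
      DoubleScaling.IsExpansion N ξ ↔
        ∀ h : ℕ, 1 ≤ h →
          ξ (2 * h - 1) =
            ((4 * h - 3)! : ℝ) *
              ∑ m ∈ Icc 1 h,
                (-1 : ℝ) ^ (m - 1) * 2 ^ (m + 2 * h - 1) / ((4 * h - 2 - m)! : ℝ) *
                  ∑ ν ∈ DoubleScaling.partitionsWithParts h m,
                    ∏ k ∈ Icc 1 h,
                      1 / ((ν k)! : ℝ) *
                        (((2 : ℝ) ^ (2 * k - 1) - 1) * ((4 * k - 3)‼ : ℝ) *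
                          |(bernoulli (2 * k) : ℝ)| / ((2 * k)! : ℝ)) ^ ν k := by
  refine ⟨fun μ hμ => DoubleScaling.existsUnique_saddlePoint hμ, fun N hN ξ => ?_⟩
  have hcoeff : ∀ h : ℕ, 1 ≤ h → DoubleScaling.saddleCoeff h = _ := fun h hh =>
    DoubleScaling.lagrange_coeff_eq_sum_partitions
      DoubleScaling.constantCoeff_bernoulliWeightSeries hh
  simp only [DoubleScaling.bernoulliWeightSeries, PowerSeries.coeff_mk] at hcoeff
  constructor
  · intro hξ h hh
    rw [← hcoeff h hh]
    obtain ⟨ξ', hξ'⟩ : ∃ ξ' : ℕ → ℝ, ∀ h, 1 ≤ h → ξ' (2 * h - 1) = DoubleScaling.saddleCoeff h :=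
      ⟨fun i => DoubleScaling.saddleCoeff ((i + 1) / 2), fun h hh => by
        beta_reduce
        rw [show (2 * h - 1 + 1) / 2 = h by omega]⟩
    rw [← hξ' h hh]
    exact hξ.unique hN (DoubleScaling.isExpansion_of_eq_saddleCoeff N hξ') h hh
  · intro hξ
    exact DoubleScaling.isExpansion_of_eq_saddleCoeff N fun h hh =>
      (hξ h hh).trans (hcoeff h hh).symm
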